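/- Let $\mathcal L:\mathbb C[z]\to\mathbb C$ be a positive-definite linear functional, that is, $\mathcal L[p]>0$ for every polynomial $p\not\equiv 0$ with $p(x)\ge 0$ for all real $x$. Let $\{P_n\}_{n\ge 0}$ be its monic orthogonal polynomial system (monic OPS): $P_n$ is monic of degree $n$, $\mathcal L[P_nP_m]=0$ for $n\neq m$, and $\mathcal L[P_n^2]\neq 0$. For $c\in\mathbb R$ and $a\in[0,\infty)$, a sequence of monic polynomials satisfying $P_0=1$, $P_1(z)=z-c_1$ and $$zP_n(z)=P_{n+1}(z)+c_{n+1}P_n(z)+\lambda_{n+1}P_{n-1}(z),\qquad n\ge 1,$$ with complex coefficients $c_n,\lambda_n$ is said to be in the Nevai class $\mathcal N(a,c)$ if $c_n\to c$ and $\lambda_n\to a$. Let $\kappa\in\mathbb C\setminus\mathbb R$ and let $\mathcal L^{-*}$ be a Geronimus transformation of $\mathcal L$ at $\kappa$, that is, a linear functional on $\mathbb C[z]$ with $\mathcal L^{-*}[(z-\kappa)p(z)]=\mathcal L[p(z)]$ for all polynomials $p$; the number $s_0^*=\mathcal L^{-*}[1]\in\mathbb C$ is arbitrary. Put $$Q_n(z)=\mathcal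 L_y\!\left[\frac{P_n(z)-P_n(y)}{z-y}\right],$$ where $\mathcal L_y$ acts on the variable $y$. Suppose that $\{P_n\}_{n\ge0}$ is in $\mathcal N(a,c)$ and that a monic OPS with respect to $\mathcal L^{-*}$ exists. Then $s_0^*P_n(\kappa)+Q_n(\kappa)\neq 0$ for all $n\ge 0$, this monic OPS is given by $$P_0^{-*}(\kappa,z)=P_0(z),\qquad P_n^{-*}(\kappa,z)=P_n(z)-\frac{s_0^*P_n(\kappa)+Q_n(\kappa)}{s_0^*P_{n-1}(\kappa)+Q_{n-1}(\kappa)}\,P_{n-1}(z)\quad(n\ge 1),$$ and $\{P_n^{-*}(\kappa,z)\}_{n\ge0}$ is in the same Nevai class $\mathcal N(a,c)$. -/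

import Mathlib

open Polynomial Filter Topology

noncomputable section

/-- A linear functional on `ℂ[X]` is positive-definite if it is positive on every nonzero
polynomial that is nonnegative on the real line.  The order on `ℂ` is the usual partial order:
`0 ≤ w` means that `w` is real and nonnegative, `0 < w` that `w` is real and positive. -/
def IsPositiveDefinite (L : ℂ[X] →ₗ[ℂ] ℂ) : Prop :=
  open scoped ComplexOrder in
  ∀ p : ℂ[X], p ≠ 0 → (∀ x : ℝ, 0 ≤ p.eval (x : ℂ)) → 0 < L p

/-- `P` is a monic orthogonal polynomial system (OPS) with respect to the functional `L`. -/
structure IsMonicOPS (L : ℂ[X] →ₗ[ℂ] ℂ) (P : ℕ → ℂ[X]) : Prop where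
  monic : ∀ n, (P n).Monic
  natDegree_eq : ∀ n, (P n).natDegree = n
  orthogonal : ∀ n m, n ≠ m → L (P n * P m) = 0
  sq_ne_zero : ∀ n, L (P n ^ 2) ≠ 0

/-- `P` satisfies the three-term recurrence relation
`z P_n = P_{n+1} + c_{n+1} P_n + lam_{n+1} P_{n-1}` for `n = 1, 2, …`,
with `P_0 = 1` and `P_1 = z - c_1`. -/
structure SatisfiesRecurrence (P : ℕ → ℂ[X]) (c lam : ℕ → ℂ) : Prop where
  zero : P 0 = 1
  one : P 1 = X - C (c 1)
  step : ∀ n, X * P (n + 1) = P (n + 2) + C (c (n + 2)) * P (n + 1) + C (lam (n + 2)) * P n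

/-- The Nevai class `𝒩(a, c)`, where `c ∈ ℝ` and `a ∈ [0, ∞)`: the recurrence coefficients
satisfy `c_n → c` and `lam_n → a`.  (For polynomials with `deg P_n = n` the coefficients
`c_n`, `n ≥ 1`, and `lam_n`, `n ≥ 2`, are uniquely determined by `P`.) -/
def InNevaiClass (P : ℕ → ℂ[X]) (a c : ℝ) : Prop :=
  0 ≤ a ∧ ∃ cs lam : ℕ → ℂ, SatisfiesRecurrence P cs lam ∧
    Tendsto cs atTop (𝓝 (c : ℂ)) ∧ Tendsto lam atTop (𝓝 (a : ℂ))

/-- `M` is a Geronimus transformation of `L` at `κ`: `M[(z - κ) p(z)] = L[p(z)]` for every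
polynomial `p`.  The value `M[1]` is a free parameter. -/
def IsGeronimusTransform (L : ℂ[X] →ₗ[ℂ] ℂ) (κ : ℂ) (M : ℂ[X] →ₗ[ℂ] ℂ) : Prop :=
  ∀ p : ℂ[X], M ((X - C κ) * p) = L p

/-- The value at `z` of the polynomial of the second kind associated with `p`, that is
`L_y[(p(z) - p(y)) / (z - y)]`.  The quotient is the polynomial (in the variable `X = y`)
obtained by the exact division of `p - p(z)` by `X - z`. -/
def secondKind (L : ℂ[X] →ₗ[ℂ] ℂ) (p : ℂ[X]) (z : ℂ) : ℂ :=
  L ((p - C (p.eval z)) /ₘ (X - C z))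

/-- The number `s P_n(κ) + Q_n(κ)`, where `Q_n` is the `n`-th polynomial of the second kind. -/
def geronimusDenom (L : ℂ[X] →ₗ[ℂ] ℂ) (P : ℕ → ℂ[X]) (κ s : ℂ) (n : ℕ) : ℂ :=
  s * (P n).eval κ + secondKind L (P n) κ

/-- The Geronimus transformation of the polynomials `P_n` at `κ` with parameter `s`:
`P_n + A_n P_{n-1}` with
`A_n = - (s P_n(κ) + Q_n(κ)) / (s P_{n-1}(κ) + Q_{n-1}(κ))` for `n ≥ 1`, and `P_0` for `n = 0`. -/
def geronimusPoly (L : ℂ[X] →ₗ[ℂ] ℂ) (P : ℕ → ℂ[X]) (κ s : ℂ) : ℕ → ℂ[X]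
  | 0 => P 0
  | n + 1 => P (n + 1) +
      C (-(geronimusDenom L P κ s (n + 1) / geronimusDenom L P κ s n)) * P n

end

/-!
The denominator `s P_n(κ) + Q_n(κ)` is the number `D_n = M[P_n]`, where `M` is the Geronimus
transform and `s = M[1]` (`geronimusDenom_eq`).

*Algebra.*  Let `S` be a monic OPS for `M`.  Since `L[S_{n+1} p] = M[S_{n+1} (z - κ) p] = 0`
whenever `deg p < n`, the polynomial `S_{n+1}` is `P_{n+1} + A P_n` for some number `A`, and
`M[S_{n+1}] = 0` says that `D_{n+1} + A D_n = 0`.  If `D_n ≠ 0` and `D_{n+1} = 0`, then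
`S_{n+1} = P_{n+1}`, and `M[P_{n+1}²] = P_{n+1}(κ) D_{n+1} = 0`, which is impossible.  Hence no `D_n`
vanishes, `S` is the sequence of the statement, and `A = -r_n` with `r_n = D_{n+1} / D_n`
(`geronimusDenom_ne_zero_and_eq`).

*Recurrence.*  Applying `M` to the recurrence of `P_n` gives
`r_n r_{n+1} = (κ - c_{n+2}) r_n - lam_{n+2}`.  The recurrence coefficients of `S` are
`c_{n+2} + r_{n+1} - r_n` and `lam_{n+2} - r_n (c_{n+1} - c_{n+2} - r_{n+1} + r_n)`, so the Nevai class
is preserved as soon as `r_n` converges, to any limit, zero included.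

*Convergence.*  The roots `w₁`, `w₂` of `w² - (κ - c) w + a` have different moduli because `κ` is not
real (`exists_roots_norm_lt`).  By a Poincaré type argument, `r_n` then converges to one of them
(`exists_tendsto_of_perturbed_riccati`): for each `K` the cone `|r - w₁| ≤ K |r - w₂|` is eventually
invariant, with `|r - w₁| / |r - w₂|` asymptotically contracted; so either this quotient tends to `0`,
or the orbit eventually leaves every such cone and the inverse quotient tends to `0`.
-/

/-! ### A perturbed Riccati recursion -/

/-- A sequence that contracts up to a null error is null. -/
lemma tendsto_zero_of_le_mul_add {t ε : ℕ → ℝ} {ρ : ℝ} (hρ0 : 0 ≤ ρ) (hρ : ρ < 1)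
    (ht0 : ∀ n, 0 ≤ t n) (hε : Tendsto ε atTop (𝓝 0))
    (ht : ∀ᶠ n in atTop, t (n + 1) ≤ ρ * t n + ε n) : Tendsto t atTop (𝓝 0) := by
  rw [Metric.tendsto_atTop]
  intro δ hδ
  have hδ' : 0 < (1 - ρ) * (δ / 2) := mul_pos (by linarith) (by linarith)
  obtain ⟨N, hN⟩ := eventually_atTop.1 (ht.and (hε.eventually (gt_mem_nhds hδ')))
  have key : ∀ k, t (N + k) ≤ ρ ^ k * t N + δ / 2 := by
    intro k
    induction k with
    | zero => simp; linarith
    | succ k ih =>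
      obtain ⟨h1, h2⟩ := hN (N + k) (by omega)
      have h3 := mul_le_mul_of_nonneg_left ih hρ0
      rw [← add_assoc, pow_succ]
      nlinarith
  have hlim : Tendsto (fun k => ρ ^ k * t N) atTop (𝓝 0) := by
    simpa using (tendsto_pow_atTop_nhds_zero_of_lt_one hρ0 hρ).mul_const (t N)
  obtain ⟨k₀, hk₀⟩ := eventually_atTop.1 (hlim.eventually (gt_mem_nhds (half_pos hδ)))
  refine ⟨N + k₀, fun n hn => ?_⟩
  obtain ⟨k, rfl⟩ := Nat.exists_eq_add_of_le (show N ≤ n by omega)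
  have h1 := key k
  have h2 := hk₀ k (by omega)
  rw [Real.dist_eq, sub_zero, abs_of_nonneg (ht0 _)]
  linarith

/-- Inverting the Möbius map `r ↦ (r - w₁) / (r - w₂)` at its zero. -/
lemma tendsto_of_tendsto_div_sub {r : ℕ → ℂ} {w₁ w₂ : ℂ} (hw : w₁ ≠ w₂)
    (h : Tendsto (fun n => (r n - w₁) / (r n - w₂)) atTop (𝓝 0))
    (hr : ∀ᶠ n in atTop, r n ≠ w₂) : Tendsto r atTop (𝓝 w₁) := by
  have h1 : Tendsto (fun n => (w₁ - w₂ * ((r n - w₁) / (r n - w₂))) /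
      (1 - (r n - w₁) / (r n - w₂))) atTop (𝓝 ((w₁ - w₂ * 0) / (1 - 0))) :=
    (tendsto_const_nhds.sub (h.const_mul w₂)).div (tendsto_const_nhds.sub h) (by simp)
  simp only [mul_zero, sub_zero, div_one] at h1
  refine h1.congr' ?_
  filter_upwards [hr] with n hn
  have h2 : r n - w₂ ≠ 0 := sub_ne_zero.2 hn
  have h3 : w₁ - w₂ ≠ 0 := sub_ne_zero.2 hw
  have h4 : 1 - (r n - w₁) / (r n - w₂) = (w₁ - w₂) / (r n - w₂) := by
    field_simp; ring
  rw [h4]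
  field_simp
  ring

/-- Error bounds for the recursion in terms of the distances to the two fixed points of the limit
map.  The error is linear in `r`, and `|r|` and `1` are both bounded by a multiple of
`|r - w₁| + |r - w₂|`, which is what keeps the estimate uniform for unbounded `r`. -/
lemma exists_perturbed_riccati_bounds {r β l : ℕ → ℂ} {w₁ w₂ : ℂ} (hw : w₁ ≠ w₂)
    (hβ : Tendsto β atTop (𝓝 (w₁ + w₂))) (hl : Tendsto l atTop (𝓝 (w₁ * w₂)))
    (hrec : ∀ n, r n * r (n + 1) = β n * r n - l n) :
    ∃ η : ℕ → ℝ, Tendsto η atTop (𝓝 0) ∧ (∀ n, 0 ≤ η n) ∧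
      (∀ n, ‖r n‖ * ‖r (n + 1) - w₁‖ ≤ ‖w₂‖ * ‖r n - w₁‖ + η n * (‖r n - w₁‖ + ‖r n - w₂‖)) ∧
      (∀ n, ‖w₁‖ * ‖r n - w₂‖ ≤ ‖r n‖ * ‖r (n + 1) - w₂‖ + η n * (‖r n - w₁‖ + ‖r n - w₂‖)) := by
  have hd : 0 < ‖w₁ - w₂‖ := norm_pos_iff.2 (sub_ne_zero.2 hw)
  have hsum : ∀ n, ‖w₁ - w₂‖ ≤ ‖r n - w₁‖ + ‖r n - w₂‖ := fun n => by
    have h : w₁ - w₂ = (r n - w₂) - (r n - w₁) := by ring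
    have := norm_sub_le (r n - w₂) (r n - w₁)
    rw [← h] at this
    linarith
  set C₁ : ℝ := 1 + ‖w₂‖ / ‖w₁ - w₂‖ with hC₁
  set C₂ : ℝ := 1 / ‖w₁ - w₂‖ with hC₂
  have hone : ∀ n, 1 ≤ C₂ * (‖r n - w₁‖ + ‖r n - w₂‖) := fun n => by
    rw [hC₂, one_div_mul_eq_div, le_div_iff₀ hd]
    linarith [hsum n]
  have hnr : ∀ n, ‖r n‖ ≤ C₁ * (‖r n - w₁‖ + ‖r n - w₂‖) := fun n => by
    have h1 : ‖r n‖ ≤ ‖r n - w₂‖ + ‖w₂‖ := by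
      simpa using norm_add_le (r n - w₂) w₂
    have h2 : ‖w₂‖ ≤ ‖w₂‖ / ‖w₁ - w₂‖ * (‖r n - w₁‖ + ‖r n - w₂‖) := by
      have := mul_le_mul_of_nonneg_left (hone n) (norm_nonneg w₂)
      rw [hC₂] at this
      calc ‖w₂‖ = ‖w₂‖ * 1 := by ring
        _ ≤ _ := this
        _ = _ := by ring
    rw [hC₁, add_mul, one_mul]
    linarith [norm_nonneg (r n - w₁)]
  have herr : ∀ n, ‖(β n - (w₁ + w₂)) * r n - (l n - w₁ * w₂)‖ ≤
      (‖β n - (w₁ + w₂)‖ * C₁ + ‖l n - w₁ * w₂‖ * C₂) * (‖r n - w₁‖ + ‖r n - w₂‖) := fun n => by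
    calc _ ≤ ‖β n - (w₁ + w₂)‖ * ‖r n‖ + ‖l n - w₁ * w₂‖ * 1 := by
          rw [mul_one, ← norm_mul]; exact norm_sub_le _ _
      _ ≤ ‖β n - (w₁ + w₂)‖ * (C₁ * (‖r n - w₁‖ + ‖r n - w₂‖)) +
          ‖l n - w₁ * w₂‖ * (C₂ * (‖r n - w₁‖ + ‖r n - w₂‖)) := by
          gcongr
          exacts [hnr n, hone n]
      _ = _ := by ring
  refine ⟨fun n => ‖β n - (w₁ + w₂)‖ * C₁ + ‖l n - w₁ * w₂‖ * C₂, ?_, fun n => ?_,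
    fun n => ?_, fun n => ?_⟩
  · have h1 := (tendsto_iff_norm_sub_tendsto_zero.1 hβ).mul_const C₁
    have h2 := (tendsto_iff_norm_sub_tendsto_zero.1 hl).mul_const C₂
    simpa using h1.add h2
  · positivity
  · have h : r n * (r (n + 1) - w₁) =
        w₂ * (r n - w₁) + ((β n - (w₁ + w₂)) * r n - (l n - w₁ * w₂)) := by
      linear_combination hrec n
    rw [← norm_mul, h, ← norm_mul]
    exact (norm_add_le _ _).trans (add_le_add_right (herr n) _)
  · have h : w₁ * (r n - w₂) =
        r n * (r (n + 1) - w₂) - ((β n - (w₁ + w₂)) * r n - (l n - w₁ * w₂)) := by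
      linear_combination -hrec n
    rw [← norm_mul, h, ← norm_mul]
    exact (norm_sub_le _ _).trans (add_le_add_right (herr n) _)

/-- An orbit that enters a fixed cone `|r - w₁| ≤ K |r - w₂|` infinitely often converges to the
attracting fixed point `w₁`. -/
lemma tendsto_of_frequently_mem_cone {r : ℕ → ℂ} {w₁ w₂ : ℂ} (hlt : ‖w₂‖ < ‖w₁‖)
    (hr0 : ∀ n, r n ≠ 0) {η : ℕ → ℝ} (hη : Tendsto η atTop (𝓝 0)) (hη0 : ∀ n, 0 ≤ η n)
    (hu : ∀ n, ‖r n‖ * ‖r (n + 1) - w₁‖ ≤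
      ‖w₂‖ * ‖r n - w₁‖ + η n * (‖r n - w₁‖ + ‖r n - w₂‖))
    (hv : ∀ n, ‖w₁‖ * ‖r n - w₂‖ ≤
      ‖r n‖ * ‖r (n + 1) - w₂‖ + η n * (‖r n - w₁‖ + ‖r n - w₂‖))
    {K : ℝ} (hK : 0 < K) (hfreq : ∃ᶠ n in atTop, ‖r n - w₁‖ ≤ K * ‖r n - w₂‖) :
    Tendsto r atTop (𝓝 w₁) := by
  have hw : w₁ ≠ w₂ := fun h => by simp [h] at hlt
  have hpos : ∀ n, 0 < ‖r n‖ := fun n => norm_pos_iff.2 (hr0 n)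
  set p := ‖w₂‖ with hp
  set q := ‖w₁‖ with hq
  have hp0 : 0 ≤ p := norm_nonneg _
  have hsmall : Tendsto (fun n => η n * (K + 1)) atTop (𝓝 0) := by
    simpa using hη.mul_const (K + 1)
  have hsmall2 : Tendsto (fun n => η n * (K + 1) * (K + 1)) atTop (𝓝 0) := by
    simpa using hsmall.mul_const (K + 1)
  -- The cone is invariant once `η n * (K + 1) ^ 2 < K * (q - p)`.
  have hinv : ∀ᶠ n in atTop, ‖r n - w₁‖ ≤ K * ‖r n - w₂‖ →
      ‖r (n + 1) - w₁‖ ≤ K * ‖r (n + 1) - w₂‖ := by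
    filter_upwards [hsmall2.eventually (gt_mem_nhds (mul_pos hK (sub_pos.2 hlt)))] with n hn hc
    have hsum : η n * (‖r n - w₁‖ + ‖r n - w₂‖) ≤ η n * (K + 1) * ‖r n - w₂‖ := by
      rw [mul_assoc]
      exact mul_le_mul_of_nonneg_left (by linarith) (hη0 n)
    refine le_of_mul_le_mul_left ?_ (hpos n)
    have h1 := hu n
    have h2 := mul_le_mul_of_nonneg_left (hv n) hK.le
    have h3 := mul_le_mul_of_nonneg_left hc hp0
    have h4 := mul_le_mul_of_nonneg_left hsum hK.le
    have h5 := mul_le_mul_of_nonneg_right hn.le (norm_nonneg (r n - w₂))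
    linarith
  have hev : ∀ᶠ n in atTop, ‖r n - w₁‖ ≤ K * ‖r n - w₂‖ := by
    obtain ⟨N, hN⟩ := eventually_atTop.1 hinv
    obtain ⟨m, hm, hmc⟩ := frequently_atTop.1 hfreq N
    refine eventually_atTop.2 ⟨m, fun n hn => ?_⟩
    induction n, hn using Nat.le_induction with
    | base => exact hmc
    | succ n hn ih => exact hN n (hm.trans hn) ih
  have hne : ∀ n, ‖r n - w₁‖ ≤ K * ‖r n - w₂‖ → 0 < ‖r n - w₂‖ := fun n hc => by
    refine norm_pos_iff.2 fun h0 => hw ?_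
    rw [h0, norm_zero, mul_zero] at hc
    rw [← sub_eq_zero.1 (norm_le_zero_iff.1 hc), sub_eq_zero.1 h0]
  refine tendsto_of_tendsto_div_sub hw ?_ (hev.mono fun n hn =>
    sub_ne_zero.1 (norm_pos_iff.1 (hne n hn)))
  rw [tendsto_zero_iff_norm_tendsto_zero]
  -- Once `η n * (K + 1) < (q - p) / 2`, the denominator `‖r n‖ * ‖r (n + 1) - w₂‖` is at least
  -- `(p + q) / 2 * ‖r n - w₂‖`, and the quotient is contracted by `p / ((p + q) / 2) < 1`.
  have hq' : 0 < (p + q) / 2 := by linarith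
  refine tendsto_zero_of_le_mul_add (ρ := p / ((p + q) / 2))
    (ε := fun n => η n * (K + 1) / ((p + q) / 2)) (by positivity)
    ((div_lt_one hq').2 (by linarith)) (fun n => norm_nonneg _) (by simpa using hsmall.div_const _) ?_
  filter_upwards [hev, (tendsto_add_atTop_nat 1).eventually hev,
    hsmall.eventually (gt_mem_nhds (show 0 < (q - p) / 2 by linarith))] with n hc hc' hn
  have hv0 := hne n hc
  have hv1 := hne _ hc'
  have hsum : η n * (‖r n - w₁‖ + ‖r n - w₂‖) ≤ η n * (K + 1) * ‖r n - w₂‖ := by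
    rw [mul_assoc]
    exact mul_le_mul_of_nonneg_left (by linarith) (hη0 n)
  have hden : (p + q) / 2 * ‖r n - w₂‖ ≤ ‖r n‖ * ‖r (n + 1) - w₂‖ := by
    have := mul_le_mul_of_nonneg_right hn.le hv0.le
    linarith [hv n]
  have hnum : ‖r n‖ * ‖r (n + 1) - w₁‖ ≤ p * ‖r n - w₁‖ + η n * (K + 1) * ‖r n - w₂‖ := by
    linarith [hu n]
  calc ‖(r (n + 1) - w₁) / (r (n + 1) - w₂)‖
      = (‖r n‖ * ‖r (n + 1) - w₁‖) / (‖r n‖ * ‖r (n + 1) - w₂‖) := by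
        rw [norm_div, mul_div_mul_left _ _ (hpos n).ne']
    _ ≤ (p * ‖r n - w₁‖ + η n * (K + 1) * ‖r n - w₂‖) / ((p + q) / 2 * ‖r n - w₂‖) := by
        refine div_le_div₀ ?_ hnum (mul_pos hq' hv0) hden
        exact (mul_nonneg (norm_nonneg _) (norm_nonneg _)).trans hnum
    _ = _ := by
        rw [norm_div]
        field_simp

/-- The recursion `r_{n+1} = β_n - l_n / r_n` converges when `β` and `l` do and the fixed points of
the limit map `r ↦ w₁ + w₂ - w₁ w₂ / r` have different moduli; the limit may be either one. -/
lemma exists_tendsto_of_perturbed_riccati {r β l : ℕ → ℂ} {w₁ w₂ : ℂ} (hlt : ‖w₂‖ < ‖w₁‖)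
    (hβ : Tendsto β atTop (𝓝 (w₁ + w₂))) (hl : Tendsto l atTop (𝓝 (w₁ * w₂)))
    (hr0 : ∀ n, r n ≠ 0) (hrec : ∀ n, r n * r (n + 1) = β n * r n - l n) :
    ∃ w, Tendsto r atTop (𝓝 w) := by
  have hw : w₁ ≠ w₂ := fun h => by simp [h] at hlt
  obtain ⟨η, hη, hη0, hu, hv⟩ := exists_perturbed_riccati_bounds hw hβ hl hrec
  by_cases hcase : ∃ K : ℝ, 0 < K ∧ ∃ᶠ n in atTop, ‖r n - w₁‖ ≤ K * ‖r n - w₂‖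
  · obtain ⟨K, hK, hfreq⟩ := hcase
    exact ⟨w₁, tendsto_of_frequently_mem_cone hlt hr0 hη hη0 hu hv hK hfreq⟩
  · simp only [not_exists, not_and, not_frequently, not_le] at hcase
    have hne : ∀ᶠ n in atTop, r n ≠ w₁ := by
      filter_upwards [hcase 1 one_pos] with n hn h0
      rw [h0, sub_self, norm_zero] at hn
      exact absurd hn (not_lt.2 (by positivity))
    refine ⟨w₂, tendsto_of_tendsto_div_sub hw.symm ?_ hne⟩
    rw [Metric.tendsto_nhds]
    intro δ hδ
    filter_upwards [hcase δ⁻¹ (inv_pos.2 hδ), hne] with n hn hn0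
    rw [dist_zero_right, norm_div, div_lt_iff₀ (norm_pos_iff.2 (sub_ne_zero.2 hn0))]
    rwa [inv_mul_lt_iff₀ hδ] at hn

/-- Roots of equal modulus would be complex conjugates of each other, since their product is
nonnegative; then their sum would be real. -/
lemma exists_roots_norm_lt {b : ℂ} (hb : b.im ≠ 0) {a : ℝ} (ha : 0 ≤ a) :
    ∃ w₁ w₂ : ℂ, ‖w₂‖ < ‖w₁‖ ∧ w₁ + w₂ = b ∧ w₁ * w₂ = a := by
  obtain ⟨s, hs⟩ := IsAlgClosed.exists_pow_nat_eq (b ^ 2 - 4 * a) (n := 2) two_pos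
  have hadd : (b + s) / 2 + (b - s) / 2 = b := by ring
  have hmul : (b + s) / 2 * ((b - s) / 2) = a := by linear_combination -hs / 4
  generalize (b + s) / 2 = w₁ at hadd hmul
  generalize (b - s) / 2 = w₂ at hadd hmul
  rcases lt_trichotomy ‖w₁‖ ‖w₂‖ with h | h | h
  · exact ⟨w₂, w₁, h, by rw [add_comm, hadd], by rw [mul_comm, hmul]⟩
  · exfalso
    have h1 : ‖w₁‖ * ‖w₁‖ = a := by
      have := congrArg norm hmul
      rw [norm_mul, ← h, Complex.norm_real, Real.norm_of_nonneg ha] at this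
      exact this
    have hw1 : w₁ ≠ 0 := by
      rintro rfl
      rw [norm_zero, eq_comm, norm_eq_zero] at h
      apply hb
      simp [← hadd, h]
    have h2 : w₂ = (starRingEnd ℂ) w₁ := by
      refine mul_left_cancel₀ hw1 ?_
      rw [hmul, Complex.mul_conj, Complex.normSq_eq_norm_sq, ← h1, sq]
    apply hb
    rw [← hadd, h2, Complex.add_im, Complex.conj_im, add_neg_cancel]
  · exact ⟨w₁, w₂, h, hadd, hmul⟩

/-! ### Monic orthogonal polynomial systems -/

namespace IsMonicOPS

variable {L : ℂ[X] →ₗ[ℂ] ℂ} {P : ℕ → ℂ[X]}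

lemma coeff_self (hP : IsMonicOPS L P) (n : ℕ) : (P n).coeff n = 1 := by
  have := (hP.monic n).coeff_natDegree
  rwa [hP.natDegree_eq] at this

lemma degree_eq (hP : IsMonicOPS L P) (n : ℕ) : (P n).degree = n := by
  rw [degree_eq_natDegree (hP.monic n).ne_zero, hP.natDegree_eq]

lemma degree_sub_C_coeff_mul_lt (hP : IsMonicOPS L P) {k : ℕ} {p : ℂ[X]}
    (hp : p.degree < (k + 1 : ℕ)) : (p - C (p.coeff k) * P k).degree < k := by
  rw [degree_lt_iff_coeff_zero] at hp ⊢
  intro m hm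
  rw [coeff_sub, coeff_C_mul]
  rcases hm.eq_or_lt with rfl | hm
  · rw [hP.coeff_self, mul_one, sub_self]
  · have h : (P k).coeff m = 0 :=
      coeff_eq_zero_of_natDegree_lt (by rw [hP.natDegree_eq]; exact hm)
    rw [hp m hm, h, mul_zero, sub_zero]

lemma apply_mul_eq_zero (hP : IsMonicOPS L P) {n : ℕ} {p : ℂ[X]} (hp : p.degree < n) :
    L (P n * p) = 0 := by
  suffices h : ∀ k ≤ n, ∀ p : ℂ[X], p.degree < k → L (P n * p) = 0 from h n le_rfl p hp
  intro k
  induction k with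
  | zero =>
    intro _ p hp
    have : p = 0 := by simpa using hp
    simp [this]
  | succ k ih =>
    intro hk p hp
    have h1 := ih (by omega) _ (hP.degree_sub_C_coeff_mul_lt hp)
    rw [mul_sub, map_sub, mul_left_comm, ← smul_eq_C_mul, map_smul,
      hP.orthogonal n k (by omega), smul_zero, sub_zero] at h1
    exact h1

lemma zero_eq_one (hP : IsMonicOPS L P) : P 0 = 1 :=
  (hP.monic 0).natDegree_eq_zero.1 (hP.natDegree_eq 0)

/-- A functional with an OPS is nondegenerate on each space of polynomials of bounded degree. -/
lemma eq_zero_of_forall_apply_mul_eq_zero (hP : IsMonicOPS L P) {n : ℕ} {p : ℂ[X]}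
    (hp : p.degree < n) (h : ∀ q : ℂ[X], q.degree < n → L (p * q) = 0) : p = 0 := by
  by_contra hp0
  have hk : p.degree = p.natDegree := degree_eq_natDegree hp0
  have hdeg : (p - C p.leadingCoeff * P p.natDegree).degree < p.natDegree :=
    hP.degree_sub_C_coeff_mul_lt (by rw [hk]; exact_mod_cast Nat.lt_succ_self _)
  have h1 := hP.apply_mul_eq_zero hdeg
  have h2 := h (P p.natDegree) (by rw [hP.degree_eq, ← hk]; exact hp)
  rw [mul_sub, map_sub, mul_comm _ p, h2, mul_left_comm, ← smul_eq_C_mul, map_smul, zero_sub,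
    neg_eq_zero, smul_eq_mul, ← sq] at h1
  exact mul_ne_zero (leadingCoeff_ne_zero.2 hp0) (hP.sq_ne_zero _) h1

end IsMonicOPS

/-! ### The Geronimus transformation -/

section Geronimus

variable {L M : ℂ[X] →ₗ[ℂ] ℂ} {P S : ℕ → ℂ[X]} {κ : ℂ}

lemma eq_C_eval_add_X_sub_C_mul_divByMonic (p : ℂ[X]) (z : ℂ) :
    p = C (p.eval z) + (X - C z) * ((p - C (p.eval z)) /ₘ (X - C z)) := by
  have h : (X - C z) * ((p - C (p.eval z)) /ₘ (X - C z)) = p - C (p.eval z) :=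
    mul_divByMonic_eq_iff_isRoot.2 (by simp [IsRoot])
  rw [h]
  ring

lemma geronimusDenom_eq (hM : IsGeronimusTransform L κ M) (n : ℕ) :
    geronimusDenom L P κ (M 1) n = M (P n) := by
  rw [geronimusDenom, secondKind, ← hM, mul_comm (M 1), ← smul_eq_mul, ← map_smul, ← map_add,
    smul_eq_C_mul, mul_one, ← eq_C_eval_add_X_sub_C_mul_divByMonic]

/-- An OPS for `M` is quasi-orthogonal of order one for `L`. -/
lemma exists_eq_add_C_mul (hP : IsMonicOPS L P) (hS : IsMonicOPS M S)
    (hM : IsGeronimusTransform L κ M) (n : ℕ) :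
    ∃ A : ℂ, S (n + 1) = P (n + 1) + C A * P n := by
  have hd : (S (n + 1) - P (n + 1)).degree < (n + 1 : ℕ) := by
    have h := hP.degree_sub_C_coeff_mul_lt (k := n + 1) (p := S (n + 1))
      (by rw [hS.degree_eq]; exact_mod_cast Nat.lt_succ_self _)
    rwa [hS.coeff_self, C_1, one_mul] at h
  refine ⟨(S (n + 1) - P (n + 1)).coeff n, ?_⟩
  have h0 := hP.eq_zero_of_forall_apply_mul_eq_zero (hP.degree_sub_C_coeff_mul_lt hd) (by
    intro q hq
    have hq' : q.degree < (n + 1 : ℕ) := hq.trans (by exact_mod_cast Nat.lt_succ_self n)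
    have h1 : L (S (n + 1) * q) = 0 := by
      rw [← hM, mul_left_comm]
      refine hS.apply_mul_eq_zero ?_
      by_cases hq0 : q = 0
      · rw [hq0, mul_zero, degree_zero]
        exact WithBot.bot_lt_coe _
      · rw [degree_mul, degree_X_sub_C, degree_eq_natDegree hq0]
        have h2 : q.natDegree < n := (natDegree_lt_iff_degree_lt hq0).2 hq
        exact_mod_cast (by omega : 1 + q.natDegree < n + 1)
    rw [sub_mul, sub_mul, map_sub, map_sub, h1, hP.apply_mul_eq_zero hq', mul_assoc,
      ← smul_eq_C_mul, map_smul, hP.apply_mul_eq_zero hq]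
    simp)
  linear_combination h0

/-- The orthogonality `M[S_{n+1}] = 0` fixes the coefficient of `P_n` in `S_{n+1}`, as long as
`M[P_n] ≠ 0`; and `M[P_{n+1}] = 0` would make `S_{n+1} = P_{n+1}` isotropic for `M`. -/
lemma geronimusDenom_ne_zero_and_eq (hP : IsMonicOPS L P) (hS : IsMonicOPS M S)
    (hM : IsGeronimusTransform L κ M) (n : ℕ) :
    geronimusDenom L P κ (M 1) n ≠ 0 ∧ S n = geronimusPoly L P κ (M 1) n := by
  induction n with
  | zero =>
    have h := hS.sq_ne_zero 0
    rw [hS.zero_eq_one, one_pow] at h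
    refine ⟨?_, ?_⟩
    · rwa [geronimusDenom_eq hM, hP.zero_eq_one]
    · rw [hS.zero_eq_one, geronimusPoly, hP.zero_eq_one]
  | succ n ih =>
    obtain ⟨A, hA⟩ := exists_eq_add_C_mul hP hS hM n
    have hD := ih.1
    have h0 : M (P (n + 1)) + A * M (P n) = 0 := by
      have h := hS.orthogonal (n + 1) 0 (by omega)
      rwa [hS.zero_eq_one, mul_one, hA, map_add, ← smul_eq_C_mul, map_smul, smul_eq_mul] at h
    rw [geronimusPoly, hA]
    simp only [geronimusDenom_eq hM] at hD ⊢
    refine ⟨fun hD' => ?_, ?_⟩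
    · have hA0 : A = 0 := by
        rw [hD', zero_add] at h0
        exact (mul_eq_zero.1 h0).resolve_right hD
      rw [hA0, C_0, zero_mul, add_zero] at hA
      apply hS.sq_ne_zero (n + 1)
      set q := (P (n + 1) - C ((P (n + 1)).eval κ)) /ₘ (X - C κ) with hq
      have hsq : P (n + 1) ^ 2 =
          C ((P (n + 1)).eval κ) * P (n + 1) + (X - C κ) * (P (n + 1) * q) := by
        linear_combination P (n + 1) * eq_C_eval_add_X_sub_C_mul_divByMonic (P (n + 1)) κ
      have hqd : q.degree < (n + 1 : ℕ) := by
        by_cases hq0 : q = 0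
        · rw [hq0, degree_zero]
          exact WithBot.bot_lt_coe _
        · rw [← natDegree_lt_iff_degree_lt hq0, hq, natDegree_divByMonic _ (monic_X_sub_C κ),
            natDegree_sub_C, hP.natDegree_eq, natDegree_X_sub_C]
          omega
      rw [hA, hsq, map_add, hM, ← smul_eq_C_mul, map_smul, hD', hP.apply_mul_eq_zero hqd,
        smul_zero, add_zero]
    · have hA' : A = -(M (P (n + 1)) / M (P n)) := by
        field_simp
        linear_combination h0
      rw [hA']

/-- Applying `M` to the three-term recurrence of `P`. -/
lemma geronimusDenom_add_two (hP : IsMonicOPS L P) (hM : IsGeronimusTransform L κ M)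
    {c lam : ℕ → ℂ} (hR : SatisfiesRecurrence P c lam) (n : ℕ) :
    geronimusDenom L P κ (M 1) (n + 2) =
      (κ - c (n + 2)) * geronimusDenom L P κ (M 1) (n + 1) -
        lam (n + 2) * geronimusDenom L P κ (M 1) n := by
  simp only [geronimusDenom_eq hM]
  have h1 : L (P (n + 1)) = 0 := by
    simpa [hP.zero_eq_one] using hP.orthogonal (n + 1) 0 (by omega)
  rw [← hM] at h1
  have h2 : (X - C κ) * P (n + 1) = P (n + 2) + (c (n + 2) - κ) • P (n + 1) +
      lam (n + 2) • P n := by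
    rw [smul_eq_C_mul, smul_eq_C_mul, C_sub]
    linear_combination hR.step n
  rw [h2] at h1
  simp only [map_add, map_smul, smul_eq_mul] at h1
  linear_combination h1

/-- The recurrence coefficients `c_n` of the polynomials `P_n - r_{n-1} P_{n-1}`.  The value at `0`
is arbitrary. -/
def transformedDiag (c r : ℕ → ℂ) : ℕ → ℂ
  | 0 => 0
  | 1 => c 1 + r 0
  | n + 2 => c (n + 2) + r (n + 1) - r n

/-- The recurrence coefficients `lam_n` of the polynomials `P_n - r_{n-1} P_{n-1}`.  The values at
`0` and `1` are arbitrary. -/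
def transformedOffDiag (c lam r : ℕ → ℂ) : ℕ → ℂ
  | 0 => 0
  | 1 => 0
  | n + 2 => lam (n + 2) - r n * (c (n + 1) - transformedDiag c r (n + 2))

lemma satisfiesRecurrence_transformed {c lam r : ℕ → ℂ} (hR : SatisfiesRecurrence P c lam)
    (hr : ∀ n, r n * r (n + 1) = (κ - c (n + 2)) * r n - lam (n + 2))
    (h0 : S 0 = P 0) (hS : ∀ n, S (n + 1) = P (n + 1) + C (-(r n)) * P n) :
    SatisfiesRecurrence S (transformedDiag c r) (transformedOffDiag c lam r) where
  zero := h0.trans hR.zero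
  one := by
    rw [hS, hR.zero, hR.one]
    simp only [transformedDiag, C_add, C_neg]
    ring
  step n := by
    match n with
    | 0 =>
      have h1 := hR.step 0
      rw [hS, hS, h0, hR.zero] at *
      have h2 := hR.one
      simp only [transformedDiag, transformedOffDiag, C_add, C_neg, C_sub, C_mul, zero_add] at *
      linear_combination h1 + C (r 0) * h2
    | n + 1 =>
      have h1 := hR.step (n + 1)
      have h2 := hR.step n
      have h3 : C (r n) * C (r (n + 1)) =
          (C κ - C (c (n + 2))) * C (r n) - C (lam (n + 2)) := by
        simpa only [C_add, C_neg, C_sub, C_mul] using congrArg C (hr n)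
      have h4 : C (r (n + 1)) * C (r (n + 2)) =
          (C κ - C (c (n + 3))) * C (r (n + 1)) - C (lam (n + 3)) := by
        simpa only [C_add, C_neg, C_sub, C_mul] using congrArg C (hr (n + 1))
      rw [hS, hS, hS]
      simp only [transformedDiag, transformedOffDiag, C_add, C_neg, C_sub, C_mul, add_assoc,
        Nat.reduceAdd] at *
      linear_combination h1 - C (r (n + 1)) * h2 +
        (C (r n) * h4 - C (r (n + 1)) * h3) * P n

end Geronimus

theorem mainTheorem4
    (L : ℂ[X] →ₗ[ℂ] ℂ) (hL : IsPositiveDefinite L)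
    (P : ℕ → ℂ[X]) (hP : IsMonicOPS L P)
    (a c : ℝ) (hN : InNevaiClass P a c)
    (κ : ℂ) (hκ : κ.im ≠ 0)
    (M : ℂ[X] →ₗ[ℂ] ℂ) (hM : IsGeronimusTransform L κ M)
    (hex : ∃ S : ℕ → ℂ[X], IsMonicOPS M S) :
    (∀ n, geronimusDenom L P κ (M 1) n ≠ 0) ∧
      IsMonicOPS M (geronimusPoly L P κ (M 1)) ∧
      InNevaiClass (geronimusPoly L P κ (M 1)) a c := by
  obtain ⟨S, hS⟩ := hex
  obtain ⟨ha, cs, lam, hR, hcs, hlam⟩ := hN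
  have hD := fun n => (geronimusDenom_ne_zero_and_eq hP hS hM n).1
  have hSeq : S = geronimusPoly L P κ (M 1) :=
    funext fun n => (geronimusDenom_ne_zero_and_eq hP hS hM n).2
  refine ⟨hD, hSeq ▸ hS, ha, ?_⟩
  set D := geronimusDenom L P κ (M 1) with hDdef
  set r : ℕ → ℂ := fun n => D (n + 1) / D n with hr
  have hr0 : ∀ n, r n ≠ 0 := fun n => div_ne_zero (hD _) (hD _)
  have hrec : ∀ n, r n * r (n + 1) = (κ - cs (n + 2)) * r n - lam (n + 2) := fun n => by
    have h := geronimusDenom_add_two hP hM hR n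
    rw [← hDdef] at h
    have h0 := hD n
    have h1 := hD (n + 1)
    simp only [hr]
    field_simp
    linear_combination h
  obtain ⟨w₁, w₂, hlt, hadd, hmul⟩ :=
    exists_roots_norm_lt (b := κ - c) (by simpa using hκ) ha
  have hcs1 := (tendsto_add_atTop_iff_nat 1).2 hcs
  have hcs2 := (tendsto_add_atTop_iff_nat 2).2 hcs
  have hlam2 := (tendsto_add_atTop_iff_nat 2).2 hlam
  obtain ⟨w, hw⟩ := exists_tendsto_of_perturbed_riccati hlt
    (β := fun n => κ - cs (n + 2)) (l := fun n => lam (n + 2))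
    (by rw [hadd]; exact tendsto_const_nhds.sub hcs2) (by rw [hmul]; exact hlam2) hr0 hrec
  have hw1 := (tendsto_add_atTop_iff_nat 1).2 hw
  have hdiag : Tendsto (fun n => transformedDiag cs r (n + 2)) atTop (𝓝 (c : ℂ)) := by
    have h := (hcs2.add hw1).sub hw
    rwa [add_sub_cancel_right] at h
  refine ⟨transformedDiag cs r, transformedOffDiag cs lam r,
    satisfiesRecurrence_transformed hR hrec rfl fun n => rfl,
    (tendsto_add_atTop_iff_nat 2).1 hdiag, (tendsto_add_atTop_iff_nat 2).1 ?_⟩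
  have h := hlam2.sub (hw.mul (hcs1.sub hdiag))
  rwa [sub_self, mul_zero, sub_zero] at h
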